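/- Let $(M,d)$ be a complete metric space with a distinguished base point $0\in M$. Let $\mathrm{Lip}_0(M)$ be the space of all Lipschitz functions $f:M\to\mathbb{R}$ with $f(0)=0$, normed by $\mathrm{Lip}(f)=\sup\{(f(x)-f(y))/d(x,y): x\neq y\in M\}$ (the supremum being $0$ if $M=\{0\}$), and for $x\in M$ let $\delta(x)\in \mathrm{Lip}_0(M)^*$ be the evaluation functional $f\mapsto f(x)$. The Lipschitz-free space over $M$ is the Banach space $\mathcal{F}(M)=\overline{\mathrm{span}}\,\delta(M)\subset \mathrm{Lip}_0(M)^*$. For a closed set $K\subset M$ with $0\in K$, identify $\mathcal{F}(K)$ with the subspace $\overline{\mathrm{span}}\,\delta(K)$ of $\mathcal{F}(M)$. A series $\sum_n y_n$ in a Banach space $Y$ is called weakly unconditionally Cauchy (WUC) if $\sum_n|\varphi(y_n)|<\infty$ for every $\varphi\in Y^*$. A subset $\Gamma$ of a Banach space $X$ is called a (V$^*$)-set if $\lim_{n\to\infty}\sup_{x\in\Gamma}|x_n^*(x)|=0$ for every WUC series $\sum_n x_n^*$ in $X^*$. Theorem. Let $\Gamma\subset\mathcal{F}(M)$ be a (V$^*$)-set.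 Then $\Gamma$ is tight, that is, for every $\varepsilon>0$ there exists a compact set $K\subset M$ with $0\in K$ such that $\Gamma\subset\mathcal{F}(K)+\varepsilon B_{\mathcal{F}(M)}$, where $B_{\mathcal{F}(M)}$ is the closed unit ball of $\mathcal{F}(M)$. Consequently, $\Gamma$ is separable. -/

import Mathlib

open Filter Topology
open scoped NNReal ENNReal Pointwise

section LipschitzFunctions

variable {M : Type*} [MetricSpace M]

/-- The real Lipschitz functions on `M` that vanish at the base point `o`, as a linear subspace of
the space of all real functions on `M`. -/
def lipZeroSubmodule (o : M) : Submodule ℝ (M → ℝ) where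
  carrier := {f | (∃ C : ℝ≥0, LipschitzWith C f) ∧ f o = 0}
  add_mem' := by
    rintro f g ⟨⟨C, hC⟩, hf⟩ ⟨⟨D, hD⟩, hg⟩
    exact ⟨⟨C + D, hC.add hD⟩, by simp [hf, hg]⟩
  zero_mem' := ⟨⟨0, LipschitzWith.const 0⟩, rfl⟩
  smul_mem' := by
    rintro c f ⟨⟨C, hC⟩, hf⟩
    refine ⟨⟨‖c‖₊ * C, LipschitzWith.of_dist_le_mul fun x y => ?_⟩, by simp [hf]⟩
    have h := mul_le_mul_of_nonneg_left (hC.dist_le_mul x y) (norm_nonneg c)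
    simpa [dist_eq_norm, ← mul_sub, mul_assoc] using h

/-- The space `Lip₀(M)` of real Lipschitz functions on the pointed metric space `(M, o)` that vanish
at `o`. It is a type of its own, so that its topology is that of the Lipschitz norm below and not
that of pointwise convergence. -/
def LipZero (o : M) : Type _ := lipZeroSubmodule o

namespace LipZero

variable {o : M}

noncomputable instance : AddCommGroup (LipZero o) := inferInstanceAs (AddCommGroup (lipZeroSubmodule o))

noncomputable instance : Module ℝ (LipZero o) := inferInstanceAs (Module ℝ (lipZeroSubmodule o))

instance : CoeFun (LipZero o) (fun _ => M → ℝ) := ⟨fun f => f.1⟩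

theorem ext {f g : LipZero o} (h : ∀ x, f x = g x) : f = g := Subtype.ext (funext h)

theorem add_apply (f g : LipZero o) (x : M) : (f + g) x = f x + g x := rfl

theorem neg_apply (f : LipZero o) (x : M) : (-f) x = -f x := rfl

theorem zero_apply (x : M) : (0 : LipZero o) x = 0 := rfl

theorem smul_apply (c : ℝ) (f : LipZero o) (x : M) : (c • f) x = c * f x := rfl

theorem apply_base (f : LipZero o) : f o = 0 := f.2.2

/-- The difference quotients of `f`. -/
def slopes (f : LipZero o) : Set ℝ := {r | ∃ x y : M, x ≠ y ∧ r = (f x - f y) / dist x y}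

/-- The norm of `Lip₀(M)` is the best Lipschitz constant
`sup {(f x - f y) / d(x, y) : x ≠ y}`. The set is bounded above because `f` is Lipschitz, and it is
empty exactly when `M` is a single point, where the norm is `0`. -/
noncomputable def lipNorm (f : LipZero o) : ℝ := sSup f.slopes

theorem bddAbove_slopes (f : LipZero o) : BddAbove f.slopes := by
  obtain ⟨C, hC⟩ := f.2.1
  refine ⟨C, ?_⟩
  rintro _ ⟨x, y, hxy, rfl⟩
  rw [div_le_iff₀ (dist_pos.2 hxy)]
  have h := hC.dist_le_mul x y
  rw [Real.dist_eq] at h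
  exact (le_abs_self _).trans h

theorem sub_le_lipNorm_mul (f : LipZero o) (x y : M) : f x - f y ≤ f.lipNorm * dist x y := by
  rcases eq_or_ne x y with rfl | h
  · simp
  · rw [← div_le_iff₀ (dist_pos.2 h)]
    exact le_csSup f.bddAbove_slopes ⟨x, y, h, rfl⟩

theorem lipNorm_le_of_forall (f : LipZero o) {C : ℝ} (hC : 0 ≤ C)
    (h : ∀ x y, f x - f y ≤ C * dist x y) : f.lipNorm ≤ C := by
  refine Real.sSup_le ?_ hC
  rintro _ ⟨x, y, hxy, rfl⟩
  rw [div_le_iff₀ (dist_pos.2 hxy)]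
  exact h x y

theorem lipNorm_nonneg (f : LipZero o) : 0 ≤ f.lipNorm := by
  by_cases h : ∃ x y : M, x ≠ y
  · obtain ⟨x, y, hxy⟩ := h
    have h1 := f.sub_le_lipNorm_mul x y
    have h2 := f.sub_le_lipNorm_mul y x
    rw [dist_comm y x] at h2
    have hd := dist_pos.2 hxy
    by_contra hn
    nlinarith
  · have : f.slopes = ∅ := by
      ext r
      constructor
      · rintro ⟨x, y, hxy, -⟩
        exact h ⟨x, y, hxy⟩
      · exact fun hr => hr.elim
    rw [lipNorm, this, Real.sSup_empty]

theorem abs_sub_le_lipNorm_mul (f : LipZero o) (x y : M) : |f x - f y| ≤ f.lipNorm * dist x y := by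
  rw [abs_le]
  have h := f.sub_le_lipNorm_mul y x
  rw [dist_comm y x] at h
  exact ⟨by linarith, f.sub_le_lipNorm_mul x y⟩

theorem abs_apply_le_lipNorm_mul (f : LipZero o) (x : M) : |f x| ≤ f.lipNorm * dist x o := by
  simpa [apply_base] using f.abs_sub_le_lipNorm_mul x o

theorem lipNorm_smul_le (c : ℝ) (f : LipZero o) : (c • f).lipNorm ≤ |c| * f.lipNorm := by
  refine lipNorm_le_of_forall _ (mul_nonneg (abs_nonneg c) f.lipNorm_nonneg) fun x y => ?_
  rw [smul_apply, smul_apply, ← mul_sub]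
  refine (le_abs_self _).trans ?_
  rw [abs_mul, mul_assoc]
  exact mul_le_mul_of_nonneg_left (f.abs_sub_le_lipNorm_mul x y) (abs_nonneg c)

noncomputable instance : NormedAddCommGroup (LipZero o) :=
  AddGroupNorm.toNormedAddCommGroup
    { toFun := lipNorm
      map_zero' := le_antisymm
        (lipNorm_le_of_forall _ le_rfl fun x y => by simp [zero_apply]) (lipNorm_nonneg _)
      add_le' := fun f g =>
        lipNorm_le_of_forall _ (add_nonneg f.lipNorm_nonneg g.lipNorm_nonneg) fun x y => by
          have h1 := f.sub_le_lipNorm_mul x y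
          have h2 := g.sub_le_lipNorm_mul x y
          rw [add_apply, add_apply]
          linarith
      neg' := fun f => by
        have key : ∀ g : LipZero o, (-g).lipNorm ≤ g.lipNorm := fun g => by
          simpa using lipNorm_smul_le (-1) g
        exact le_antisymm (key f) (by simpa using key (-f))
      eq_zero_of_map_eq_zero' := fun f hf => ext fun x => by
        have h := f.abs_apply_le_lipNorm_mul x
        change f.lipNorm = 0 at hf
        rw [hf, zero_mul] at h
        exact abs_nonpos_iff.1 h }

theorem norm_def (f : LipZero o) : ‖f‖ = sSup f.slopes := rfl

theorem abs_apply_le (f : LipZero o) (x : M) : |f x| ≤ ‖f‖ * dist x o :=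
  f.abs_apply_le_lipNorm_mul x

noncomputable instance : NormedSpace ℝ (LipZero o) where
  norm_smul_le c f := lipNorm_smul_le c f

end LipZero

end LipschitzFunctions

section LipschitzFree

variable {M : Type*} [MetricSpace M]

/-- The evaluation functional `δ(x) : f ↦ f x` on `Lip₀(M)`. -/
noncomputable def lipEval (o x : M) : StrongDual ℝ (LipZero o) :=
  LinearMap.mkContinuous
    { toFun := fun f : LipZero o => f x
      map_add' := fun _ _ => rfl
      map_smul' := fun _ _ => rfl }
    (dist x o) (fun f => (f.abs_apply_le x).trans_eq (mul_comm _ _))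

/-- The closed linear span of the evaluation functionals in the dual of `Lip₀(M)`. -/
noncomputable def lipFreeSubmodule (o : M) : Submodule ℝ (StrongDual ℝ (LipZero o)) :=
  (Submodule.span ℝ (Set.range (lipEval o))).topologicalClosure

/-- The Lipschitz-free space `F(M)` of the pointed metric space `(M, o)`: the closed linear span of
the evaluation functionals, with the norm of the dual of `Lip₀(M)`. -/
def LipFree (o : M) : Type _ := lipFreeSubmodule o

noncomputable instance (o : M) : NormedAddCommGroup (LipFree o) :=
  inferInstanceAs (NormedAddCommGroup (lipFreeSubmodule o))

noncomputable instance (o : M) : NormedSpace ℝ (LipFree o) :=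
  inferInstanceAs (NormedSpace ℝ (lipFreeSubmodule o))

/-- The canonical map `δ : M → F(M)`. -/
noncomputable def lipDelta (o x : M) : LipFree o :=
  ⟨lipEval o x, Submodule.le_topologicalClosure _ (Submodule.subset_span ⟨x, rfl⟩)⟩

/-- `F(K)` as a subspace of `F(M)`: the closed linear span of `δ(K)`. -/
noncomputable def lipFreeOn (o : M) (K : Set M) : Submodule ℝ (LipFree o) :=
  (Submodule.span ℝ (lipDelta o '' K)).topologicalClosure

/-- A set `Γ` in `F(M)` is tight if for every `ε > 0` there is a compact `K ⊆ M` containing the base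
point such that `Γ ⊆ F(K) + ε B`, where `B` is the closed unit ball of `F(M)`. -/
def IsTightLipFree (o : M) (Γ : Set (LipFree o)) : Prop :=
  ∀ ε : ℝ, 0 < ε → ∃ K : Set M, IsCompact K ∧ o ∈ K ∧
    Γ ⊆ (lipFreeOn o K : Set (LipFree o)) + ε • Metric.closedBall (0 : LipFree o) 1

end LipschitzFree

section VStarSets

variable {X : Type*} [NormedAddCommGroup X] [NormedSpace ℝ X]

/-- The formal series `∑ xₙ` is weakly unconditionally Cauchy: `∑ |φ(xₙ)| < ∞` for every
continuous linear functional `φ`. -/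
def IsWUC (x : ℕ → X) : Prop :=
  ∀ φ : StrongDual ℝ X, Summable fun n => |φ (x n)|

/-- `Γ` is a (V*)-set: `sup_{x ∈ Γ} |φₙ(x)| → 0` for every WUC series `∑ φₙ` in the dual. The
supremum is taken in `[0, ∞]`. -/
def IsVStarSet (Γ : Set X) : Prop :=
  ∀ φ : ℕ → StrongDual ℝ X, IsWUC φ →
    Tendsto (fun n => ⨆ x ∈ Γ, ENNReal.ofReal |φ n x|) atTop (𝓝 0)

end VStarSets

/-! ### Multiplication and separated sums in `LipZero`. -/

namespace LipZero

variable {M : Type*} [MetricSpace M] {o : M}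

/-! Gliding humps in `LipZero o` control the set, and multiplication operators turn that control
into a compact support.

If functions `g n` satisfy `|g n x| + |g m y| ≤ L * dist x y` on their respective supports for `n ≠
m`, every signed finite sum has norm at most `L` (`norm_sum_smul_le`), so they define a WUC series
in the dual of the free space. A (V*)-set therefore admits no `γ n ∈ Γ` with `|γ n (g n)|` bounded
away from `0`. Each `γ` is nearly determined by finitely many point values (`exists_finite_abs_le`),
so cutting a test function off near a suitable finite set costs little. Two hump constructions
follow: humps in distant annuli show that `Γ` is concentrated on a ball, and bounded humps at mutual
distance at least `δ / 2` show that, inside a ball, it is concentrated near a finite set.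

The adjoint of multiplication by a cut-off moves each `γ ∈ Γ` by a small amount and shrinks
supports. Operator images of (V*)-sets are (V*)-sets, so this can be iterated with radii tending to
`0` and summable errors. The limits are supported on an intersection of neighbourhoods of finite
sets, which is compact because `M` is complete. Hahn-Banach places them in the free space of that
compact set. -/

theorem abs_sub_le (f : LipZero o) (x y : M) : |f x - f y| ≤ ‖f‖ * dist x y :=
  f.abs_sub_le_lipNorm_mul x y

theorem norm_le_of_abs_sub_le (f : LipZero o) {C : ℝ} (hC : 0 ≤ C)
    (h : ∀ x y, |f x - f y| ≤ C * dist x y) : ‖f‖ ≤ C :=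
  f.lipNorm_le_of_forall hC fun x y => (le_abs_self _).trans (h x y)

theorem sub_apply (f g : LipZero o) (x : M) : (f - g) x = f x - g x := rfl

theorem sum_apply {ι : Type*} (s : Finset ι) (f : ι → LipZero o) (x : M) :
    (∑ i ∈ s, f i) x = ∑ i ∈ s, f i x := by
  classical
  induction s using Finset.induction_on with
  | empty => rfl
  | insert a s ha ih => rw [Finset.sum_insert ha, Finset.sum_insert ha, add_apply, ih]

/-- A function vanishing at the base point with a bound on its slopes, as an element of
`LipZero o`. -/
def mk (f : M → ℝ) (hf : f o = 0) (C : ℝ) (h : ∀ x y, |f x - f y| ≤ C * dist x y) : LipZero o :=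
  ⟨f, ⟨C.toNNReal, LipschitzWith.of_dist_le_mul fun x y => by
    rw [Real.dist_eq]
    exact (h x y).trans (mul_le_mul_of_nonneg_right (Real.le_coe_toNNReal C) dist_nonneg)⟩, hf⟩

theorem mk_apply (f : M → ℝ) (hf : f o = 0) (C : ℝ) (h : ∀ x y, |f x - f y| ≤ C * dist x y)
    (x : M) : mk f hf C h x = f x := rfl

/-- The slopes of a product `f * h` when `h` takes values in `[0, 1]` and `f` is bounded on the
support of `h`. -/
theorem abs_mul_sub_mul_le (f : LipZero o) {h : M → ℝ} {l B : ℝ} (h0 : ∀ x, 0 ≤ h x)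
    (h1 : ∀ x, h x ≤ 1) (hl : ∀ x y, |h x - h y| ≤ l * dist x y)
    (hB0 : 0 ≤ B) (hB : ∀ x, h x ≠ 0 → |f x| ≤ B) (x y : M) :
    |f x * h x - f y * h y| ≤ (‖f‖ + B * l) * dist x y := by
  -- The product rule is split so that `f` is evaluated at the point where `h ≠ 0`, the only place
  -- where it is known to be bounded.
  have key : ∀ x y : M, h x ≠ 0 → |f x * h x - f y * h y| ≤ (‖f‖ + B * l) * dist x y := by
    intro x y hx
    have e : f x * h x - f y * h y = f x * (h x - h y) + (f x - f y) * h y := by ring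
    rw [e]
    refine (abs_add_le _ _).trans ?_
    rw [abs_mul, abs_mul, abs_of_nonneg (h0 y)]
    have a1 := mul_le_mul (hB x hx) (hl x y) (abs_nonneg _) hB0
    have a2 := mul_le_mul (f.abs_sub_le x y) (h1 y) (h0 y)
      ((abs_nonneg _).trans (f.abs_sub_le x y))
    linarith
  by_cases hx : h x = 0
  · by_cases hy : h y = 0
    · have hz := (abs_nonneg _).trans (hl x y)
      rw [hx, hy, mul_zero, mul_zero, sub_zero, abs_zero, add_mul]
      have := mul_nonneg (norm_nonneg f) (dist_nonneg (x := x) (y := y))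
      have := mul_nonneg hB0 hz
      rw [mul_assoc B]
      linarith
    · rw [abs_sub_comm, dist_comm]
      exact key y x hy
  · exact key x y hx

/-- Multiplication by a bounded Lipschitz function `h` as an operator on `LipZero o`. -/
noncomputable def mulCLM (h : M → ℝ) (C : ℝ)
    (hC : ∀ (f : LipZero o) (x y : M), |f x * h x - f y * h y| ≤ C * ‖f‖ * dist x y) :
    LipZero o →L[ℝ] LipZero o :=
  LinearMap.mkContinuous
    { toFun := fun f => mk (fun x => f x * h x) (by simp [apply_base]) (C * ‖f‖) (hC f)
      map_add' := fun f g => ext fun x => by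
        simp only [mk_apply, add_apply]; ring
      map_smul' := fun c f => ext fun x => by
        simp only [mk_apply, smul_apply, RingHom.id_apply]; ring }
    (max C 0) (fun f => by
      refine norm_le_of_abs_sub_le _ (by positivity) fun x y => (hC f x y).trans ?_
      gcongr
      exact le_max_left _ _)

theorem mulCLM_apply (h : M → ℝ) (C : ℝ)
    (hC : ∀ (f : LipZero o) (x y : M), |f x * h x - f y * h y| ≤ C * ‖f‖ * dist x y)
    (f : LipZero o) (x : M) : mulCLM h C hC f x = f x * h x := rfl

theorem norm_mulCLM_apply_le (h : M → ℝ) (C : ℝ) (hC0 : 0 ≤ C)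
    (hC : ∀ (f : LipZero o) (x y : M), |f x * h x - f y * h y| ≤ C * ‖f‖ * dist x y)
    (f : LipZero o) : ‖mulCLM h C hC f‖ ≤ C * ‖f‖ :=
  norm_le_of_abs_sub_le _ (by positivity) (hC f)

/-- If the functions `g n` have Lipschitz constant at most `L` and their supports are separated
relative to their sizes, then signed sums of them have Lipschitz constant at most `L`. -/
theorem norm_sum_smul_le {g : ℕ → LipZero o} {L : ℝ} (hL : ∀ n, ‖g n‖ ≤ L)
    (hsep : ∀ n m x y, n ≠ m → g n x ≠ 0 → g m y ≠ 0 → |g n x| + |g m y| ≤ L * dist x y)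
    (s : Finset ℕ) (c : ℕ → ℝ) (hc : ∀ n, |c n| ≤ 1) : ‖∑ n ∈ s, c n • g n‖ ≤ L := by
  have hL0 : 0 ≤ L := (norm_nonneg _).trans (hL 0)
  have hdisj : ∀ n m x, n ≠ m → g n x ≠ 0 → g m x = 0 := by
    intro n m x hnm hn
    by_contra hm
    have h := hsep n m x x hnm hn hm
    rw [dist_self, mul_zero] at h
    have := abs_pos.2 hn
    have := abs_nonneg (g m x)
    linarith
  have hsum : ∀ x n, g n x ≠ 0 →
      (∑ k ∈ s, c k • g k) x = if n ∈ s then c n * g n x else 0 := by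
    intro x n hn
    rw [sum_apply, ← Finset.sum_ite_eq' s n fun k => c k * g k x]
    refine Finset.sum_congr rfl fun k _ => ?_
    rw [smul_apply]
    split_ifs with hk
    · rfl
    · rw [hdisj n k x (Ne.symm hk) hn, mul_zero]
  have hzero : ∀ x, (∀ n, g n x = 0) → (∑ k ∈ s, c k • g k) x = 0 := by
    intro x hx
    rw [sum_apply]
    exact Finset.sum_eq_zero fun k _ => by rw [smul_apply, hx, mul_zero]
  have hmul : ∀ n (t : ℝ), |c n * t| ≤ |t| := fun n t => by
    rw [abs_mul]
    exact mul_le_of_le_one_left (abs_nonneg _) (hc n)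
  have hone : ∀ n x y, |g n x - g n y| ≤ L * dist x y := fun n x y =>
    ((g n).abs_sub_le x y).trans (mul_le_mul_of_nonneg_right (hL n) dist_nonneg)
  have hsame : ∀ x y n, |(if n ∈ s then c n * g n x else 0) - (if n ∈ s then c n * g n y else 0)|
      ≤ L * dist x y := by
    intro x y n
    split_ifs
    · rw [← mul_sub]
      exact (hmul n _).trans (hone n x y)
    · rw [sub_zero, abs_zero]
      positivity
  refine norm_le_of_abs_sub_le _ hL0 fun x y => ?_
  by_cases hx : ∃ n, g n x ≠ 0
  · obtain ⟨n, hn⟩ := hx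
    rw [hsum x n hn]
    by_cases hy : ∃ m, g m y ≠ 0
    · obtain ⟨m, hm⟩ := hy
      by_cases hnm : n = m
      · subst hnm
        rw [hsum y n hm]
        exact hsame x y n
      · rw [hsum y m hm]
        refine le_trans ?_ (hsep n m x y hnm hn hm)
        refine (abs_sub _ _).trans (add_le_add ?_ ?_)
        · split_ifs
          · exact hmul n _
          · rw [abs_zero]; exact abs_nonneg _
        · split_ifs
          · exact hmul m _
          · rw [abs_zero]; exact abs_nonneg _
    · push Not at hy
      have := hsame x y n
      rw [hzero y hy]
      simpa [hy n] using this
  · push Not at hx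
    rw [hzero x hx]
    by_cases hy : ∃ m, g m y ≠ 0
    · obtain ⟨m, hm⟩ := hy
      have := hsame x y m
      rw [hsum y m hm]
      simpa [hx m] using this
    · push Not at hy
      rw [hzero y hy, sub_zero, abs_zero]
      positivity

end LipZero

/-! ### Cut-off functions. -/

section Bump

variable {M : Type*} [MetricSpace M]

/-- The function that is `1` within distance `r` of `A`, vanishes beyond distance `2 * r`, and is
affine in the distance in between. -/
noncomputable def bump (A : Set M) (r : ℝ) (x : M) : ℝ :=
  max 0 (min 1 (2 - Metric.infDist x A / r))

theorem bump_nonneg (A : Set M) (r : ℝ) (x : M) : 0 ≤ bump A r x := le_max_left _ _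

theorem bump_le_one (A : Set M) (r : ℝ) (x : M) : bump A r x ≤ 1 :=
  max_le zero_le_one (min_le_left _ _)

theorem bump_eq_one {A : Set M} {r : ℝ} (hr : 0 < r) {x : M} (hx : Metric.infDist x A ≤ r) :
    bump A r x = 1 := by
  have : Metric.infDist x A / r ≤ 1 := (div_le_one hr).2 hx
  rw [bump, min_eq_left (by linarith), max_eq_right zero_le_one]

theorem infDist_lt_of_bump_ne_zero {A : Set M} {r : ℝ} (hr : 0 < r) {x : M}
    (hx : bump A r x ≠ 0) : Metric.infDist x A < 2 * r := by
  by_contra! h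
  have : 2 ≤ Metric.infDist x A / r := (le_div_iff₀ hr).2 h
  exact hx (max_eq_left ((min_le_right _ _).trans (by linarith)))

theorem abs_bump_sub_le (A : Set M) {r : ℝ} (hr : 0 < r) (x y : M) :
    |bump A r x - bump A r y| ≤ 1 / r * dist x y := by
  have h1 := (Metric.lipschitz_infDist_pt A).dist_le_mul x y
  rw [Real.dist_eq, NNReal.coe_one, one_mul] at h1
  have h2 : |bump A r x - bump A r y| ≤
      |(2 - Metric.infDist x A / r) - (2 - Metric.infDist y A / r)| := by
    unfold bump
    refine (abs_max_sub_max_le_max _ _ _ _).trans ?_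
    rw [sub_self, abs_zero]
    refine max_le (abs_nonneg _) ((abs_min_sub_min_le_max _ _ _ _).trans ?_)
    rw [sub_self, abs_zero]
    exact max_le (abs_nonneg _) le_rfl
  refine h2.trans ?_
  have e : (2 - Metric.infDist x A / r) - (2 - Metric.infDist y A / r)
      = -((1 / r) * (Metric.infDist x A - Metric.infDist y A)) := by ring
  rw [e, abs_neg, abs_mul, abs_of_pos (by positivity)]
  gcongr

theorem abs_bump_mul_bump_sub_le (A B : Set M) {r s : ℝ} (hr : 0 < r) (hs : 0 < s) (x y : M) :
    |bump A r x * bump B s x - bump A r y * bump B s y| ≤ (1 / r + 1 / s) * dist x y := by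
  have e : bump A r x * bump B s x - bump A r y * bump B s y
      = (bump A r x - bump A r y) * bump B s x + bump A r y * (bump B s x - bump B s y) := by ring
  rw [e]
  refine (abs_add_le _ _).trans ?_
  rw [abs_mul, abs_mul, abs_of_nonneg (bump_nonneg _ _ _), abs_of_nonneg (bump_nonneg _ _ _)]
  have h1 := mul_le_of_le_one_right (abs_nonneg (bump A r x - bump A r y)) (bump_le_one B s x)
  have h2 := mul_le_of_le_one_left (abs_nonneg (bump B s x - bump B s y)) (bump_le_one A r y)
  have h3 := abs_bump_sub_le A hr x y
  have h4 := abs_bump_sub_le B hs x y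
  linarith

end Bump

/-! ### The free space: duality, weights and supports. -/

section Free

variable {M : Type*} [MetricSpace M] {o : M}

namespace LipFree

instance : CompleteSpace (LipFree o) :=
  inferInstanceAs (CompleteSpace (Submodule.topologicalClosure _ : Submodule ℝ _))

/-- The inclusion of the free space in the dual of `LipZero o`. -/
noncomputable def toDual : LipFree o →L[ℝ] StrongDual ℝ (LipZero o) :=
  (lipFreeSubmodule o).subtypeL

theorem norm_toDual (γ : LipFree o) : ‖toDual γ‖ = ‖γ‖ := rfl

theorem toDual_mem (γ : LipFree o) : toDual γ ∈ lipFreeSubmodule o := γ.2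

theorem toDual_lipDelta (x : M) (f : LipZero o) : toDual (lipDelta o x) f = f x := rfl

theorem toDual_injective : Function.Injective (toDual (o := o)) := Subtype.val_injective

theorem norm_le_of_forall {γ : LipFree o} {C : ℝ} (hC : 0 ≤ C)
    (h : ∀ f : LipZero o, ‖f‖ ≤ 1 → |toDual γ f| ≤ C) : ‖γ‖ ≤ C := by
  rw [← norm_toDual]
  exact ContinuousLinearMap.opNorm_le_of_unit_norm hC fun f hf => h f hf.le

/-- The functional on the free space induced by a Lipschitz function. -/
noncomputable def ofLip : LipZero o →L[ℝ] StrongDual ℝ (LipFree o) :=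
  (toDual (o := o)).flip

theorem ofLip_apply (f : LipZero o) (γ : LipFree o) : ofLip f γ = toDual γ f := rfl

/-- Finite combinations of evaluations approximate `γ` in norm. Such a combination sees only the
values on a finite set, and the error is controlled by the bound `L` on the norm. -/
theorem exists_finite_abs_le (γ : LipFree o) (L : ℝ) {ε : ℝ} (hε : 0 < ε) :
    ∃ F : Set M, F.Finite ∧ ∃ η : ℝ, 0 < η ∧ ∀ g : LipZero o, ‖g‖ ≤ L →
      (∀ x ∈ F, |g x| ≤ η) → |toDual γ g| ≤ ε := by
  have hspan : ∀ φ ∈ Submodule.span ℝ (Set.range (lipEval o)), ∃ F : Set M, F.Finite ∧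
      ∃ C : ℝ, 0 ≤ C ∧ ∀ (g : LipZero o) (η : ℝ), 0 ≤ η → (∀ x ∈ F, |g x| ≤ η) →
        |φ g| ≤ C * η := by
    intro φ hφ
    induction hφ using Submodule.span_induction with
    | mem φ h =>
      obtain ⟨x, rfl⟩ := h
      refine ⟨{x}, Set.finite_singleton x, 1, zero_le_one, fun g η _ hg => ?_⟩
      rw [one_mul]
      exact hg x rfl
    | zero => exact ⟨∅, Set.finite_empty, 0, le_rfl, fun g η _ _ => by simp⟩
    | add φ ψ _ _ h1 h2 =>
      obtain ⟨F, hF, C, hC, h⟩ := h1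
      obtain ⟨G, hG, D, hD, h'⟩ := h2
      refine ⟨F ∪ G, hF.union hG, C + D, add_nonneg hC hD, fun g η h0 hg => ?_⟩
      rw [add_apply, add_mul]
      exact (abs_add_le _ _).trans (add_le_add (h g η h0 fun x hx => hg x (Or.inl hx))
        (h' g η h0 fun x hx => hg x (Or.inr hx)))
    | smul c φ _ h1 =>
      obtain ⟨F, hF, C, hC, h⟩ := h1
      refine ⟨F, hF, |c| * C, by positivity, fun g η h0 hg => ?_⟩
      rw [smul_apply, smul_eq_mul, abs_mul, mul_assoc]
      exact mul_le_mul_of_nonneg_left (h g η h0 hg) (abs_nonneg c)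
  have hL : 0 < |L| + 1 := by positivity
  obtain ⟨φ, hφ, hdist⟩ := Metric.mem_closure_iff.1 (toDual_mem γ) (ε / 2 / (|L| + 1))
    (by positivity)
  obtain ⟨F, hF, C, hC, h⟩ := hspan φ hφ
  refine ⟨F, hF, ε / 2 / (C + 1), by positivity, fun g hg hgF => ?_⟩
  have h1 := h g _ (by positivity) hgF
  have h2 : C * (ε / 2 / (C + 1)) ≤ ε / 2 := by
    rw [← mul_div_assoc, div_le_iff₀ (by positivity)]
    nlinarith
  have h3 : |(toDual γ - φ) g| ≤ ε / 2 := by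
    rw [dist_eq_norm] at hdist
    have h4 := (toDual γ - φ).le_opNorm g
    rw [Real.norm_eq_abs] at h4
    refine h4.trans ?_
    have h5 : ‖g‖ ≤ |L| + 1 := hg.trans ((le_abs_self L).trans (by linarith))
    calc _ ≤ (ε / 2 / (|L| + 1)) * (|L| + 1) :=
          mul_le_mul hdist.le h5 (norm_nonneg _) (by positivity)
      _ = ε / 2 := by field_simp
  have e : toDual γ g = (toDual γ - φ) g + φ g := by
    rw [sub_apply]; ring
  rw [e]
  exact (abs_add_le _ _).trans (by linarith)

/-- The adjoint of an operator on `LipZero o` that preserves the free space. -/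
noncomputable def preadjoint (T : LipZero o →L[ℝ] LipZero o)
    (hT : ∀ x, (lipEval o x).comp T ∈ lipFreeSubmodule o) : LipFree o →L[ℝ] LipFree o :=
  ((ContinuousLinearMap.compL ℝ (LipZero o) (LipZero o) ℝ).flip T ∘L toDual).codRestrict
    (lipFreeSubmodule o) (fun γ => by
      have hle : lipFreeSubmodule o ≤ (lipFreeSubmodule o).comap
          ((ContinuousLinearMap.compL ℝ (LipZero o) (LipZero o) ℝ).flip T).toLinearMap := by
        refine Submodule.topologicalClosure_minimal _ (Submodule.span_le.2 ?_)
          ((Submodule.isClosed_topologicalClosure _).preimage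
            ((ContinuousLinearMap.compL ℝ (LipZero o) (LipZero o) ℝ).flip T).continuous)
        rintro _ ⟨x, rfl⟩
        exact hT x
      exact hle (toDual_mem γ))

/-- The operator on the free space with `δ x ↦ h x • δ x`. -/
noncomputable def weight (h : M → ℝ) (C : ℝ)
    (hC : ∀ (f : LipZero o) (x y : M), |f x * h x - f y * h y| ≤ C * ‖f‖ * dist x y) :
    LipFree o →L[ℝ] LipFree o :=
  preadjoint (LipZero.mulCLM h C hC) fun x => by
    have e : (lipEval o x).comp (LipZero.mulCLM h C hC) = h x • lipEval o x := by
      ext f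
      exact mul_comm _ _
    rw [e]
    exact Submodule.smul_mem _ _
      (Submodule.le_topologicalClosure _ (Submodule.subset_span ⟨x, rfl⟩))

theorem toDual_weight (h : M → ℝ) (C : ℝ)
    (hC : ∀ (f : LipZero o) (x y : M), |f x * h x - f y * h y| ≤ C * ‖f‖ * dist x y)
    (γ : LipFree o) (f : LipZero o) :
    toDual (weight h C hC γ) f = toDual γ (LipZero.mulCLM h C hC f) := rfl

/-- `γ` annihilates the Lipschitz functions that vanish on `A`. -/
def SupportedOn (A : Set M) (γ : LipFree o) : Prop :=
  ∀ f : LipZero o, (∀ x ∈ A, f x = 0) → toDual γ f = 0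

theorem SupportedOn.mono {A B : Set M} {γ : LipFree o} (h : SupportedOn A γ) (hAB : A ⊆ B) :
    SupportedOn B γ := fun f hf => h f fun x hx => hf x (hAB hx)

theorem SupportedOn.weight {h : M → ℝ} {C : ℝ}
    {hC : ∀ (f : LipZero o) (x y : M), |f x * h x - f y * h y| ≤ C * ‖f‖ * dist x y}
    {A B : Set M} {γ : LipFree o} (hγ : SupportedOn A γ) (hB : ∀ x, h x ≠ 0 → x ∈ B) :
    SupportedOn (A ∩ B) (weight h C hC γ) := by
  intro f hf
  rw [toDual_weight]
  refine hγ _ fun x hx => ?_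
  rw [LipZero.mulCLM_apply]
  by_cases hh : h x = 0
  · rw [hh, mul_zero]
  · rw [hf x ⟨hx, hB x hh⟩, zero_mul]

theorem supportedOn_univ (γ : LipFree o) : SupportedOn Set.univ γ := by
  intro f hf
  have : f = 0 := LipZero.ext fun x => hf x trivial
  rw [this, map_zero]

theorem lipschitzWith_lipDelta : LipschitzWith 1 (lipDelta o) := by
  refine LipschitzWith.of_dist_le_mul fun x y => ?_
  rw [dist_eq_norm, NNReal.coe_one, one_mul]
  refine norm_le_of_forall dist_nonneg fun f hf => ?_
  rw [map_sub, sub_apply, toDual_lipDelta, toDual_lipDelta]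
  exact (f.abs_sub_le x y).trans (mul_le_of_le_one_left dist_nonneg hf)

/-- A functional on the free space is given by a Lipschitz function. -/
theorem exists_ofLip_eq (φ : StrongDual ℝ (LipFree o)) : ∃ f : LipZero o, ofLip f = φ := by
  refine ⟨LipZero.mk (fun x => φ (lipDelta o x)) ?_ ‖φ‖ fun x y => ?_, ?_⟩
  · have : lipDelta o o = 0 := by
      apply toDual_injective
      ext f
      rw [toDual_lipDelta, map_zero, f.apply_base]
      rfl
    rw [this, map_zero]
  · rw [← map_sub, ← Real.norm_eq_abs]
    exact (φ.le_opNorm _).trans (mul_le_mul_of_nonneg_left (by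
      simpa [dist_eq_norm] using lipschitzWith_lipDelta.dist_le_mul x y) (norm_nonneg _))
  · set f : LipZero o := LipZero.mk _ _ _ _ with hf
    have hspan : ∀ ψ ∈ Submodule.span ℝ (Set.range (lipEval o)), ∀ h : ψ ∈ lipFreeSubmodule o,
        ofLip f (⟨ψ, h⟩ : lipFreeSubmodule o) = φ (⟨ψ, h⟩ : lipFreeSubmodule o) := by
      intro ψ hψ
      induction hψ using Submodule.span_induction with
      | mem ψ h =>
        obtain ⟨x, rfl⟩ := h
        exact fun _ => rfl
      | zero => exact fun _ => (map_zero (ofLip f)).trans (map_zero φ).symm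
      | add ψ₁ ψ₂ hm₁ hm₂ h1 h2 =>
        intro h
        have e1 := h1 (Submodule.le_topologicalClosure _ hm₁)
        have e2 := h2 (Submodule.le_topologicalClosure _ hm₂)
        exact (map_add (ofLip f) _ _).trans
          ((congrArg₂ (· + ·) e1 e2).trans (map_add φ _ _).symm)
      | smul c ψ hm h1 =>
        intro h
        have e1 := h1 (Submodule.le_topologicalClosure _ hm)
        exact (map_smul (ofLip f) c _).trans
          ((congrArg (c • ·) e1).trans (map_smul φ c _).symm)
    -- Both functionals are continuous and agree on the dense span of the evaluations.
    ext γ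
    refine closure_minimal (s := {γ : LipFree o | toDual γ ∈
      Submodule.span ℝ (Set.range (lipEval o))}) (t := {γ | ofLip f γ = φ γ})
      (fun γ hγ => hspan _ hγ γ.2) (isClosed_eq (ofLip f).continuous φ.continuous) ?_
    refine Metric.mem_closure_iff.2 fun ε hε => ?_
    obtain ⟨ψ, hψ, hd⟩ := Metric.mem_closure_iff.1 (toDual_mem γ) ε hε
    exact ⟨⟨ψ, Submodule.le_topologicalClosure _ hψ⟩, hψ, hd⟩

/-- By Hahn-Banach, a point outside the closed subspace would be separated from it by a functional.
That functional is a Lipschitz function vanishing on `K`, so it annihilates `γ`. -/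
theorem SupportedOn.mem_lipFreeOn {K : Set M} {γ : LipFree o} (h : SupportedOn K γ) :
    γ ∈ lipFreeOn o K := by
  by_contra hγ
  obtain ⟨φ, u, hφ, hu⟩ := geometric_hahn_banach_closed_point (lipFreeOn o K).convex
    (Submodule.isClosed_topologicalClosure _) hγ
  have hu0 : 0 < u := by simpa using hφ 0 (lipFreeOn o K).zero_mem
  -- A functional bounded above on a subspace vanishes there: otherwise some multiple of `μ` attains
  -- the excluded value `u`.
  have hker : ∀ μ ∈ lipFreeOn o K, φ μ = 0 := by
    intro μ hμ
    by_contra hne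
    have h1 := hφ ((u / φ μ) • μ) ((lipFreeOn o K).smul_mem _ hμ)
    rw [map_smul, smul_eq_mul, div_mul_cancel₀ _ hne] at h1
    exact lt_irrefl _ h1
  obtain ⟨f, rfl⟩ := exists_ofLip_eq φ
  have hf : toDual γ f = 0 := h f fun x hx => hker (lipDelta o x)
    (Submodule.le_topologicalClosure _ (Submodule.subset_span ⟨x, hx, rfl⟩))
  rw [ofLip_apply, hf] at hu
  exact lt_asymm hu hu0

end LipFree
end Free

/-! ### (V*)-sets and gliding humps. -/

section VStar

/-- Composition with `T` sends WUC series in the dual of `Y` to WUC series in the dual of `X`. This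
is what permits iterating the cut-offs. -/
theorem IsVStarSet.image {X Y : Type*} [NormedAddCommGroup X] [NormedSpace ℝ X]
    [NormedAddCommGroup Y] [NormedSpace ℝ Y] {Γ : Set X} (hΓ : IsVStarSet Γ) (T : X →L[ℝ] Y) :
    IsVStarSet (T '' Γ) := by
  intro φ hφ
  have h := hΓ (fun n => (φ n).comp T) fun ψ =>
    hφ (ψ.comp ((ContinuousLinearMap.compL ℝ X Y ℝ).flip T))
  simp only [iSup_image]
  exact h

end VStar

namespace LipFree

variable {M : Type*} [MetricSpace M] {o : M}

/-- With coefficients the signs of `ψ (ofLip (g n))`, a partial sum of absolute values is the value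
of `ψ.comp ofLip` at a signed sum of norm at most `L`. -/
theorem isWUC_ofLip {g : ℕ → LipZero o} {L : ℝ} (hL : ∀ n, ‖g n‖ ≤ L)
    (hsep : ∀ n m x y, n ≠ m → g n x ≠ 0 → g m y ≠ 0 → |g n x| + |g m y| ≤ L * dist x y) :
    IsWUC fun n => ofLip (g n) := by
  intro ψ
  refine summable_of_sum_le (c := ‖ψ.comp ofLip‖ * L) (fun n => abs_nonneg _) fun s => ?_
  have h1 := LipZero.norm_sum_smul_le hL hsep s (fun n => SignType.sign (ψ (ofLip (g n)))) fun n => by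
    rcases SignType.sign (ψ (ofLip (g n))) <;> simp
  have h2 := ((ψ.comp ofLip).le_opNorm _).trans (mul_le_mul_of_nonneg_left h1 (norm_nonneg _))
  refine le_trans (le_of_eq ?_) ((le_abs_self _).trans h2)
  rw [map_sum]
  refine Finset.sum_congr rfl fun n _ => ?_
  rw [map_smul, smul_eq_mul, ContinuousLinearMap.comp_apply, sign_mul_self]

/-- A (V*)-set is asymptotically annihilated by uniformly Lipschitz functions with separated
supports. -/
theorem exists_abs_le_of_separated {Γ : Set (LipFree o)} (hΓ : IsVStarSet Γ) {g : ℕ → LipZero o}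
    {L : ℝ} (hL : ∀ n, ‖g n‖ ≤ L)
    (hsep : ∀ n m x y, n < m → g n x ≠ 0 → g m y ≠ 0 → |g n x| + |g m y| ≤ L * dist x y)
    {γ : ℕ → LipFree o} (hγ : ∀ n, γ n ∈ Γ) {ε : ℝ} (hε : 0 < ε) :
    ∃ n, |toDual (γ n) (g n)| ≤ ε := by
  have hw : IsWUC fun n => ofLip (g n) := isWUC_ofLip hL fun n m x y hnm hx hy => by
    rcases lt_or_gt_of_ne hnm with h | h
    · exact hsep n m x y h hx hy
    · rw [add_comm, dist_comm]
      exact hsep m n y x h hy hx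
  obtain ⟨n, hn⟩ := ((hΓ _ hw).eventually_lt_const (ENNReal.ofReal_pos.2 hε)).exists
  refine ⟨n, (ENNReal.ofReal_le_ofReal_iff hε.le).1 (le_trans ?_ hn.le)⟩
  exact le_iSup₂ (f := fun x (_ : x ∈ Γ) => ENNReal.ofReal |ofLip (g n) x|) (γ n) (hγ n)

/-- The factor `bump {o} R` confines the product to a ball where `|f| ≤ 2 * R * ‖f‖`; without it `f`
may be unbounded on the support of `bump A r`. -/
theorem abs_mul_bump_sub_le {A : Set M} {r R : ℝ} (hr : 0 < r) (hR : 0 < R)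
    (f : LipZero o) (x y : M) :
    |f x * (bump A r x * bump {o} R x) - f y * (bump A r y * bump {o} R y)| ≤
      (1 + 2 * R * (1 / r + 1 / R)) * ‖f‖ * dist x y := by
  refine (f.abs_mul_sub_mul_le (B := 2 * R * ‖f‖)
    (fun x => mul_nonneg (bump_nonneg _ _ _) (bump_nonneg _ _ _))
    (fun x => mul_le_one₀ (bump_le_one _ _ _) (bump_nonneg _ _ _) (bump_le_one _ _ _))
    (abs_bump_mul_bump_sub_le A {o} hr hR) (by positivity) (fun x hx => ?_) x y).trans
    (le_of_eq (by ring))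
  have := infDist_lt_of_bump_ne_zero hR (right_ne_zero_of_mul hx)
  rw [Metric.infDist_singleton] at this
  rw [mul_comm]
  exact (f.abs_apply_le x).trans (mul_le_mul_of_nonneg_left this.le (norm_nonneg f))

/-- The constant is `1 + 2 * R * (1 / R)`. Its independence of `R` keeps humps at all scales
uniformly Lipschitz. -/
theorem abs_mul_bump_base_sub_le {R : ℝ} (hR : 0 < R) (f : LipZero o) (x y : M) :
    |f x * bump {o} R x - f y * bump {o} R y| ≤ 3 * ‖f‖ * dist x y := by
  refine (f.abs_mul_sub_mul_le (B := 2 * R * ‖f‖) (bump_nonneg _ _) (bump_le_one _ _)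
    (abs_bump_sub_le {o} hR) (by positivity) (fun x hx => ?_) x y).trans
    (le_of_eq (by field_simp; ring))
  have := infDist_lt_of_bump_ne_zero hR hx
  rw [Metric.infDist_singleton] at this
  rw [mul_comm]
  exact (f.abs_apply_le x).trans (mul_le_mul_of_nonneg_left this.le (norm_nonneg f))

/-- The elements of a (V*)-set are uniformly concentrated on bounded sets. -/
theorem exists_radius_abs_le {Γ : Set (LipFree o)} (hΓ : IsVStarSet Γ) (L : ℝ) {ε : ℝ}
    (hε : 0 < ε) : ∃ R : ℝ, 0 < R ∧ ∀ γ ∈ Γ, ∀ f : LipZero o, ‖f‖ ≤ L →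
      (∀ x, dist x o ≤ R → f x = 0) → |toDual γ f| ≤ ε := by
  by_contra! hcon
  -- Positivity of `R` sits inside the existential, with junk values otherwise, so that `choose`
  -- yields a total map `S` that can be iterated.
  have step : ∀ R : ℝ, ∃ (γ : LipFree o) (g : LipZero o) (S : ℝ), 0 < R →
      γ ∈ Γ ∧ R ≤ S ∧ ‖g‖ ≤ 3 * L ∧ ε / 2 < |toDual γ g| ∧
      ∀ x, g x ≠ 0 → R < dist x o ∧ 2 * dist x o ≤ S := by
    intro R
    by_cases hR : 0 < R
    · obtain ⟨γ, hγ, f, hf, hfR, hbig⟩ := hcon R hR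
      obtain ⟨F, hF, η, hη, hFg⟩ := exists_finite_abs_le γ (4 * L) (half_pos hε)
      obtain ⟨D, hD⟩ := hF.isBounded.subset_closedBall o
      set R' := max R D
      have hR' : 0 < R' := hR.trans_le (le_max_left _ _)
      set g := LipZero.mulCLM (bump {o} R') 3 (abs_mul_bump_base_sub_le hR') f with hg
      have hgL : ‖g‖ ≤ 3 * L := (LipZero.norm_mulCLM_apply_le _ _ (by norm_num) _ f).trans
        (by linarith)
      -- The hump lives where `dist x o < 2 * R'`; the next one starts beyond twice that distance.
      refine ⟨γ, g, 4 * R', fun _ => ⟨hγ, ?_, hgL, ?_, fun x hx => ⟨?_, ?_⟩⟩⟩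
      · have := le_max_left R D
        linarith
      · have h1 := hFg (f - g) ((norm_sub_le _ _).trans (by linarith)) fun x hx => by
          have hx' : dist x o ≤ R' := (hD hx).trans (le_max_right _ _)
          rw [LipZero.sub_apply, hg, LipZero.mulCLM_apply, bump_eq_one hR'
            (by rwa [Metric.infDist_singleton]), mul_one, sub_self, abs_zero]
          exact hη.le
        rw [map_sub] at h1
        have := abs_sub_abs_le_abs_sub (toDual γ f) (toDual γ g)
        linarith
      · by_contra! h
        exact hx (by rw [hg, LipZero.mulCLM_apply, hfR x h, zero_mul])
      · have := infDist_lt_of_bump_ne_zero hR' (right_ne_zero_of_mul hx)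
        rw [Metric.infDist_singleton] at this
        linarith
    · exact ⟨0, 0, 0, fun h => absurd h hR⟩
  choose γ g S h using step
  let R : ℕ → ℝ := fun n => S^[n] 1
  have hRs : ∀ n, R (n + 1) = S (R n) := fun n => Function.iterate_succ_apply' S n 1
  have hR0 : ∀ n, 0 < R n := by
    intro n
    induction n with
    | zero => exact one_pos
    | succ n ih => rw [hRs]; exact ih.trans_le (h _ ih).2.1
  have hmono : Monotone R := monotone_nat_of_le_succ fun n => by
    rw [hRs]; exact (h _ (hR0 n)).2.1
  -- Here `9 = 3 * 3`: the humps have norm at most `3 * L`, and `dist y o ≥ 2 * dist x o` gives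
  -- `dist x o + dist y o ≤ 3 * dist x y`.
  obtain ⟨n, hn⟩ := exists_abs_le_of_separated (L := 9 * L) hΓ (g := fun n => g (R n))
    (γ := fun n => γ (R n))
    (fun n => by
      have := (h _ (hR0 n)).2.2.1
      have := norm_nonneg (g (R n))
      linarith)
    (fun n m x y hnm hx hy => by
      have hL : 0 ≤ 3 * L := (norm_nonneg _).trans (h _ (hR0 n)).2.2.1
      have h1 := ((h _ (hR0 n)).2.2.2.2 x hx).2
      have h2 := ((h _ (hR0 m)).2.2.2.2 y hy).1
      have h3 : S (R n) ≤ R m := hRs n ▸ hmono hnm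
      have h4 := ((g (R n)).abs_apply_le x).trans
        (mul_le_mul_of_nonneg_right (h _ (hR0 n)).2.2.1 dist_nonneg)
      have h5 := ((g (R m)).abs_apply_le y).trans
        (mul_le_mul_of_nonneg_right (h _ (hR0 m)).2.2.1 dist_nonneg)
      have h6 := dist_triangle_left y o x
      have h7 : dist x o + dist y o ≤ 3 * dist x y := by linarith
      have h8 := mul_le_mul_of_nonneg_left h7 hL
      linarith)
    (fun n => (h _ (hR0 n)).1) (half_pos hε)
  exact absurd hn (not_le.2 (h _ (hR0 n)).2.2.2.1)

/-- The elements of a (V*)-set are, on bounded sets, uniformly concentrated on neighbourhoods of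
finite sets. -/
theorem exists_finite_infDist_abs_le {Γ : Set (LipFree o)} (hΓ : IsVStarSet Γ) (L R : ℝ)
    {δ ε : ℝ} (hδ : 0 < δ) (hε : 0 < ε) :
    ∃ E : Set M, E.Finite ∧ E.Nonempty ∧ ∀ γ ∈ Γ, ∀ f : LipZero o, ‖f‖ ≤ L →
      (∀ x, R < dist x o → f x = 0) → (∀ x, Metric.infDist x E ≤ δ → f x = 0) →
      |toDual γ f| ≤ ε := by
  -- Nonemptiness of `E` matters: `Metric.infDist x ∅ = 0`, so `E = ∅` would force `f = 0`.
  by_contra! hcon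
  -- The cut-off vanishes beyond `2 * r = δ / 2` from the current finite set, and later humps start
  -- beyond `δ` from it, so supports are at least `δ / 2` apart.
  set r := δ / 4 with hr_def
  have hr : 0 < r := by positivity
  set B := |L| * |R| with hB
  have step : ∀ E : Set M, ∃ (γ : LipFree o) (g : LipZero o) (F : Set M), E.Finite → E.Nonempty →
      γ ∈ Γ ∧ F.Finite ∧ E ⊆ F ∧ ‖g‖ ≤ |L| + B * (1 / r) ∧ ε / 2 < |toDual γ g| ∧
      (∀ x, |g x| ≤ B) ∧
      ∀ x, g x ≠ 0 → δ < Metric.infDist x E ∧ Metric.infDist x F < δ / 2 := by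
    intro E
    by_cases hE : E.Finite ∧ E.Nonempty
    · obtain ⟨hEf, hEn⟩ := hE
      obtain ⟨γ, hγ, f, hf, hfR, hfE, hbig⟩ := hcon E hEf hEn
      obtain ⟨F, hF, η, hη, hFg⟩ := exists_finite_abs_le γ (|L| + (|L| + B * (1 / r)))
        (half_pos hε)
      have hfL : ‖f‖ ≤ |L| := hf.trans (le_abs_self L)
      have hfB : ∀ x, |f x| ≤ B := by
        intro x
        by_cases hx : R < dist x o
        · rw [hfR x hx, abs_zero]
          positivity
        · exact (f.abs_apply_le x).trans (mul_le_mul hfL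
            ((not_lt.1 hx).trans (le_abs_self R)) dist_nonneg (abs_nonneg L))
      set g : LipZero o := LipZero.mk (fun x => f x * bump (E ∪ F) r x)
        (by rw [f.apply_base, zero_mul]) _
        (f.abs_mul_sub_mul_le (bump_nonneg _ _) (bump_le_one _ _) (abs_bump_sub_le (E ∪ F) hr)
          (by positivity) fun x _ => hfB x) with hg
      have hgx : ∀ x, g x = f x * bump (E ∪ F) r x := fun x => rfl
      have hgL : ‖g‖ ≤ |L| + B * (1 / r) := by
        refine LipZero.norm_le_of_abs_sub_le _ (by positivity) fun x y => ?_
        refine (f.abs_mul_sub_mul_le (bump_nonneg _ _) (bump_le_one _ _)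
          (abs_bump_sub_le (E ∪ F) hr) (by positivity) (fun x _ => hfB x) x y).trans ?_
        gcongr
      refine ⟨γ, g, E ∪ F, fun _ _ => ⟨hγ, hEf.union hF, Set.subset_union_left, hgL, ?_, ?_,
        fun x hx => ⟨?_, ?_⟩⟩⟩
      · have h1 := hFg (f - g) ((norm_sub_le _ _).trans (add_le_add hfL hgL)) fun x hx => by
          rw [LipZero.sub_apply, hgx, bump_eq_one hr, mul_one, sub_self, abs_zero]
          · exact hη.le
          · rw [Metric.infDist_zero_of_mem (show x ∈ E ∪ F from Or.inr hx)]
            exact hr.le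
        rw [map_sub] at h1
        have := abs_sub_abs_le_abs_sub (toDual γ f) (toDual γ g)
        linarith
      · intro x
        rw [hgx, abs_mul, abs_of_nonneg (bump_nonneg _ _ _)]
        exact (mul_le_of_le_one_right (abs_nonneg _) (bump_le_one _ _ _)).trans (hfB x)
      · by_contra! h
        exact hx (by rw [hgx, hfE x h, zero_mul])
      · have := infDist_lt_of_bump_ne_zero hr (right_ne_zero_of_mul hx)
        linarith
    · exact ⟨0, 0, ∅, fun h1 h2 => absurd ⟨h1, h2⟩ hE⟩
  choose γ g F h using step
  let E : ℕ → Set M := fun n => F^[n] {o}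
  have hEs : ∀ n, E (n + 1) = F (E n) := fun n => Function.iterate_succ_apply' F n {o}
  have hE : ∀ n, (E n).Finite ∧ (E n).Nonempty := by
    intro n
    induction n with
    | zero => exact ⟨Set.finite_singleton o, Set.singleton_nonempty o⟩
    | succ n ih =>
      rw [hEs]
      exact ⟨(h _ ih.1 ih.2).2.1, ih.2.mono (h _ ih.1 ih.2).2.2.1⟩
  have hh := fun n => h _ (hE n).1 (hE n).2
  have hmono : Monotone E := monotone_nat_of_le_succ fun n => by
    rw [hEs]; exact (hh n).2.2.1
  have hBδ : 0 ≤ B * (1 / r) := by positivity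
  obtain ⟨n, hn⟩ := exists_abs_le_of_separated (L := |L| + B * (1 / r)) hΓ
    (g := fun n => g (E n)) (γ := fun n => γ (E n)) (fun n => (hh n).2.2.2.1)
    (fun n m x y hnm hx hy => by
      obtain ⟨-, hFf, -, -, -, hgB, hsupp⟩ := hh n
      obtain ⟨-, -, -, -, -, hgB', hsupp'⟩ := hh m
      have h1 := (hsupp x hx).2
      have h2 := (hsupp' y hy).1
      have h3 : F (E n) ⊆ E m := hEs n ▸ hmono hnm
      have h4 := Metric.infDist_le_infDist_of_subset (x := y) h3
        (hEs n ▸ (hE (n + 1)).2)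
      have h5 := Metric.infDist_le_infDist_add_dist (s := F (E n)) (x := y) (y := x)
      rw [dist_comm] at h5
      have h6 : δ / 2 ≤ dist x y := by linarith
      have h7 : B * (1 / r) * (δ / 2) = 2 * B := by rw [hr_def]; field_simp; ring
      have h8 := mul_le_mul_of_nonneg_left h6 hBδ
      have h9 := mul_nonneg (abs_nonneg L) (dist_nonneg (x := x) (y := y))
      have := hgB x
      have := hgB' y
      linarith)
    (fun n => (hh n).1) (half_pos hε)
  exact absurd hn (not_le.2 (hh n).2.2.2.2.1)

end LipFree

/-! ### Uniform approximation by weights and passage to a compact support. -/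

namespace LipFree

variable {M : Type*} [MetricSpace M] {o : M}

/-- A (V*)-set is uniformly approximated by its image under an operator with values in the
elements of bounded support. -/
theorem exists_weight_bounded {Γ : Set (LipFree o)} (hΓ : IsVStarSet Γ) {ε : ℝ} (hε : 0 < ε) :
    ∃ (R : ℝ) (W : LipFree o →L[ℝ] LipFree o), 0 < R ∧ (∀ γ ∈ Γ, ‖γ - W γ‖ ≤ ε) ∧
      ∀ γ, SupportedOn (Metric.closedBall o R) (W γ) := by
  -- `4 = 1 + 3` bounds the norm of `f` minus its cut-off when `‖f‖ ≤ 1`.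
  obtain ⟨R, hR, h⟩ := exists_radius_abs_le hΓ 4 hε
  refine ⟨2 * R, weight (bump {o} R) 3 (abs_mul_bump_base_sub_le hR), by positivity,
    fun γ hγ => norm_le_of_forall hε.le fun f hf => ?_, fun γ => ?_⟩
  · rw [map_sub, sub_apply, toDual_weight, ← map_sub]
    refine h γ hγ _ ?_ fun x hx => ?_
    · refine (norm_sub_le _ _).trans ?_
      have := LipZero.norm_mulCLM_apply_le (bump {o} R) 3 (by norm_num)
        (abs_mul_bump_base_sub_le hR) f
      linarith
    · rw [LipZero.sub_apply, LipZero.mulCLM_apply, bump_eq_one hR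
        (by rwa [Metric.infDist_singleton]), mul_one, sub_self]
  · refine ((supportedOn_univ γ).weight fun x hx => ?_).mono Set.inter_subset_right
    have := infDist_lt_of_bump_ne_zero hR hx
    rw [Metric.infDist_singleton] at this
    exact this.le

/-- A (V*)-set with bounded support is uniformly approximated by its image under an operator that
shrinks supports to a neighbourhood of a finite set. -/
theorem exists_weight_finite {Γ : Set (LipFree o)} (hΓ : IsVStarSet Γ) {R : ℝ} (hR : 0 < R)
    (hΓR : ∀ γ ∈ Γ, SupportedOn (Metric.closedBall o R) γ) {δ ε : ℝ} (hδ : 0 < δ) (hε : 0 < ε) :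
    ∃ (E : Set M) (W : LipFree o →L[ℝ] LipFree o), E.Finite ∧ E.Nonempty ∧
      (∀ γ ∈ Γ, ‖γ - W γ‖ ≤ ε) ∧ ∀ γ A, SupportedOn A γ →
        SupportedOn (A ∩ {x | Metric.infDist x E ≤ 2 * δ}) (W γ) := by
  set C := 1 + 2 * R * (1 / δ + 1 / R) with hC
  have hC0 : 0 ≤ C := by positivity
  obtain ⟨E, hE, hEn, h⟩ := exists_finite_infDist_abs_le hΓ (3 + C) (2 * R) hδ hε
  refine ⟨E, weight (fun x => bump E δ x * bump {o} R x) C (abs_mul_bump_sub_le hδ hR), hE, hEn,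
    fun γ hγ => norm_le_of_forall hε.le fun f hf => ?_, fun γ A hγ => ?_⟩
  · set T := LipZero.mulCLM (bump {o} R) 3 (abs_mul_bump_base_sub_le hR) with hT
    set T' := LipZero.mulCLM (fun x => bump E δ x * bump {o} R x) C
      (abs_mul_bump_sub_le hδ hR) with hT'
    -- Since `γ` lives on the ball of radius `R`, `f` may be replaced by `T f`. Then `T f - T' f`
    -- vanishes both outside radius `2 * R` and near `E`, as the concentration lemma requires.
    have hzero : toDual γ (f - T f) = 0 := hΓR γ hγ _ fun x hx => by
      rw [LipZero.sub_apply, hT, LipZero.mulCLM_apply, bump_eq_one hR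
        (by rwa [Metric.infDist_singleton]), mul_one, sub_self]
    have e : toDual (γ - weight (fun x => bump E δ x * bump {o} R x) C
        (abs_mul_bump_sub_le hδ hR) γ) f = toDual γ (T f - T' f) := by
      rw [map_sub, sub_apply, toDual_weight, map_sub]
      rw [map_sub] at hzero
      linarith
    rw [e]
    refine h γ hγ _ ?_ (fun x hx => ?_) fun x hx => ?_
    · refine (norm_sub_le _ _).trans (add_le_add ?_ ?_)
      · exact (LipZero.norm_mulCLM_apply_le _ 3 (by norm_num) _ f).trans (by linarith)
      · exact (LipZero.norm_mulCLM_apply_le _ C hC0 _ f).trans (mul_le_of_le_one_right hC0 hf)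
    · have h0 : bump {o} R x = 0 := by
        by_contra hne
        have := infDist_lt_of_bump_ne_zero hR hne
        rw [Metric.infDist_singleton] at this
        exact lt_asymm hx this
      rw [LipZero.sub_apply, hT, hT', LipZero.mulCLM_apply, LipZero.mulCLM_apply, h0]
      simp
    · rw [LipZero.sub_apply, hT, hT', LipZero.mulCLM_apply, LipZero.mulCLM_apply,
        bump_eq_one hδ hx, one_mul, sub_self]
  · exact hγ.weight fun x hx => (infDist_lt_of_bump_ne_zero hδ (left_ne_zero_of_mul hx)).le

section Intersection

variable {E : ℕ → Set M} {δ : ℕ → ℝ}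

/-- The exceptional finite sets allow for sequences that enter the `n`-th neighbourhood only from
some index on. -/
theorem totallyBounded_of_infDist_le (hE : ∀ n, (E n).Finite) (hEn : ∀ n, (E n).Nonempty)
    (hδ : Tendsto δ atTop (𝓝 0)) {S : Set M}
    (hS : ∀ n, ∃ F : Set M, F.Finite ∧ ∀ x ∈ S, x ∈ F ∨ Metric.infDist x (E n) ≤ δ n) :
    TotallyBounded S := by
  refine Metric.totallyBounded_iff.2 fun ε hε => ?_
  obtain ⟨n, hn⟩ := (hδ.eventually_lt_const hε).exists
  obtain ⟨F, hF, hSF⟩ := hS n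
  refine ⟨F ∪ E n, hF.union (hE n), fun x hx => ?_⟩
  rw [Set.mem_iUnion₂]
  rcases hSF x hx with h | h
  · exact ⟨x, Or.inl h, Metric.mem_ball_self hε⟩
  · obtain ⟨y, hy, hxy⟩ := (Metric.infDist_lt_iff (hEn n)).1 (h.trans_lt hn)
    exact ⟨y, Or.inr hy, hxy⟩

theorem isCompact_setOf_infDist_le [CompleteSpace M] (hE : ∀ n, (E n).Finite)
    (hEn : ∀ n, (E n).Nonempty) (hδ : Tendsto δ atTop (𝓝 0)) :
    IsCompact {x : M | ∀ n, Metric.infDist x (E n) ≤ δ n} := by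
  have hcl : IsClosed {x : M | ∀ n, Metric.infDist x (E n) ≤ δ n} := by
    rw [Set.ofPred_forall]
    exact isClosed_iInter fun n =>
      isClosed_le (Metric.continuous_infDist_pt (E n)) continuous_const
  exact isCompact_iff_totallyBounded_isComplete.2 ⟨totallyBounded_of_infDist_le hE hEn hδ
    fun n => ⟨∅, Set.finite_empty, fun x hx => Or.inr (hx n)⟩, hcl.isComplete⟩

/-- A continuous function vanishing on the intersection of neighbourhoods of finite sets with radii
tending to `0` is uniformly small on some finite intersection. -/
theorem exists_abs_le_of_forall_infDist_le [CompleteSpace M] (hE : ∀ n, (E n).Finite)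
    (hEn : ∀ n, (E n).Nonempty) (hδ : Tendsto δ atTop (𝓝 0)) {f : M → ℝ} (hf : Continuous f)
    (hf0 : ∀ x, (∀ n, Metric.infDist x (E n) ≤ δ n) → f x = 0) {η : ℝ} (hη : 0 < η) :
    ∃ N, ∀ x, (∀ n < N, Metric.infDist x (E n) ≤ δ n) → |f x| ≤ η := by
  by_contra! hcon
  choose x hx hxη using hcon
  have htb : TotallyBounded (Set.range x) := totallyBounded_of_infDist_le hE hEn hδ fun n =>
    ⟨x '' Set.Iic n, (Set.finite_Iic n).image x, by
      rintro _ ⟨k, rfl⟩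
      rcases le_or_gt k n with h | h
      · exact Or.inl ⟨k, h, rfl⟩
      · exact Or.inr (hx k n h)⟩
  have hcpt : IsCompact (closure (Set.range x)) :=
    isCompact_iff_totallyBounded_isComplete.2 ⟨htb.closure, isClosed_closure.isComplete⟩
  obtain ⟨a, -, φ, hφ, hlim⟩ := hcpt.tendsto_subseq fun n => subset_closure (Set.mem_range_self n)
  have ha : ∀ n, Metric.infDist a (E n) ≤ δ n := fun n =>
    le_of_tendsto (((Metric.continuous_infDist_pt (E n)).tendsto a).comp hlim)
      ((eventually_gt_atTop n).mono fun k hk => hx _ n (hk.trans_le (hφ.id_le k)))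
  have h1 : η ≤ |f a| := ge_of_tendsto (((continuous_abs.comp hf).tendsto a).comp hlim)
    (Eventually.of_forall fun k => (hxη _).le)
  rw [hf0 a ha, abs_zero] at h1
  exact absurd hη (not_lt.2 h1)

end Intersection

/-- Truncating a Lipschitz function near zero. -/
theorem exists_truncation (f : LipZero o) {η : ℝ} (hη : 0 < η) :
    ∃ g : LipZero o, ‖f - g‖ ≤ ‖f‖ ∧ (∀ x, |(f - g) x| ≤ η) ∧ ∀ x, |f x| ≤ η → g x = 0 := by
  let c : LipZero o := LipZero.mk (fun x => max (-η) (min η (f x)))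
    (by rw [f.apply_base, min_eq_right hη.le, max_eq_right (by linarith)]) ‖f‖ fun x y => by
      refine (abs_max_sub_max_le_max _ _ _ _).trans ?_
      rw [sub_self, abs_zero]
      refine max_le (by positivity) ((abs_min_sub_min_le_max _ _ _ _).trans ?_)
      rw [sub_self, abs_zero]
      exact max_le (by positivity) (f.abs_sub_le x y)
  have hc : ∀ x, c x = max (-η) (min η (f x)) := fun x => rfl
  refine ⟨f - c, ?_, fun x => ?_, fun x hx => ?_⟩
  · rw [sub_sub_cancel]
    refine LipZero.norm_le_of_abs_sub_le _ (norm_nonneg f) fun x y => ?_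
    refine (abs_max_sub_max_le_max _ _ _ _).trans ?_
    rw [sub_self, abs_zero]
    refine max_le (by positivity) ((abs_min_sub_min_le_max _ _ _ _).trans ?_)
    rw [sub_self, abs_zero]
    exact max_le (by positivity) (f.abs_sub_le x y)
  · rw [sub_sub_cancel, hc, abs_le]
    exact ⟨le_max_left _ _, max_le (by linarith) (min_le_left _ _)⟩
  · obtain ⟨h1, h2⟩ := abs_le.1 hx
    rw [LipZero.sub_apply, hc, min_eq_right h2, max_eq_right h1, sub_self]

/-- An element supported on all finite intersections of neighbourhoods of finite sets with radii
tending to `0` is supported on the whole intersection. -/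
theorem SupportedOn.iInter_infDist_le [CompleteSpace M] {E : ℕ → Set M} {δ : ℕ → ℝ}
    (hE : ∀ n, (E n).Finite) (hEn : ∀ n, (E n).Nonempty) (hδ : Tendsto δ atTop (𝓝 0))
    {γ : LipFree o} (hγ : ∀ N, SupportedOn {x | ∀ n < N, Metric.infDist x (E n) ≤ δ n} γ) :
    SupportedOn {x | ∀ n, Metric.infDist x (E n) ≤ δ n} γ := by
  intro f hf
  refine abs_nonpos_iff.1 (le_of_forall_pos_le_add fun ε hε => ?_)
  rw [zero_add]
  -- `γ` is small on `f - g`, which is uniformly small with norm at most `‖f‖`, and annihilates `g`,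
  -- which vanishes on a finite intersection.
  obtain ⟨F, -, η, hη, hF⟩ := exists_finite_abs_le γ ‖f‖ hε
  obtain ⟨g, hg, hgη, hg0⟩ := exists_truncation f hη
  have hcont : Continuous (f : M → ℝ) := f.2.1.choose_spec.continuous
  obtain ⟨N, hN⟩ := exists_abs_le_of_forall_infDist_le hE hEn hδ hcont hf hη
  have h1 := hF _ hg fun x _ => hgη x
  rwa [map_sub, hγ N g fun x hx => hg0 x (hN x hx), sub_zero] at h1

theorem isClosed_setOf_supportedOn (A : Set M) : IsClosed {γ : LipFree o | SupportedOn A γ} := by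
  simp only [SupportedOn, Set.ofPred_forall]
  exact isClosed_iInter fun f => isClosed_iInter fun _ =>
    isClosed_eq (ofLip f).continuous continuous_const

end LipFree

/-! ### Tightness and separability. -/

section Tight

variable {M : Type*} [MetricSpace M] {o : M}

open LipFree

/-- Compose weights for radii tending to `0`. The finite sets are chosen for all of `Γ` at once, so
a single compact set serves every limit. -/
theorem IsVStarSet.exists_isCompact_supportedOn [CompleteSpace M] {Γ : Set (LipFree o)}
    (hΓ : IsVStarSet Γ) {R : ℝ} (hR : 0 < R)
    (hΓR : ∀ γ ∈ Γ, SupportedOn (Metric.closedBall o R) γ) {ε : ℝ} (hε : 0 < ε) :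
    ∃ K : Set M, IsCompact K ∧ ∀ γ ∈ Γ, ∃ μ, ‖γ - μ‖ ≤ ε ∧ SupportedOn K μ := by
  let δ : ℕ → ℝ := fun n => 1 / ((n : ℝ) + 1)
  have hδ : ∀ n, 0 < δ n := fun n => Nat.one_div_pos_of_nat
  have hδ0 : Tendsto (fun n => 2 * δ n) atTop (𝓝 0) := by
    simpa [δ] using (tendsto_one_div_add_atTop_nhds_zero_nat (𝕜 := ℝ)).const_mul 2
  have step : ∀ (n : ℕ) (V : LipFree o →L[ℝ] LipFree o), ∃ (E : Set M)
      (W : LipFree o →L[ℝ] LipFree o),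
      (∀ γ ∈ Γ, SupportedOn (Metric.closedBall o R) (V γ)) →
      -- The errors `ε / 2 / 2 ^ n` sum to `ε`.
      E.Finite ∧ E.Nonempty ∧ (∀ γ ∈ Γ, ‖V γ - W (V γ)‖ ≤ ε / 2 / 2 ^ n) ∧
      ∀ γ A, SupportedOn A γ → SupportedOn (A ∩ {x | Metric.infDist x E ≤ 2 * δ n}) (W γ) := by
    intro n V
    by_cases hV : ∀ γ ∈ Γ, SupportedOn (Metric.closedBall o R) (V γ)
    · obtain ⟨E, W, hE, hEn, hW, hWs⟩ := exists_weight_finite (hΓ.image V) hR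
        (by rintro _ ⟨γ, hγ, rfl⟩; exact hV γ hγ) (hδ n)
        (show 0 < ε / 2 / 2 ^ n by positivity)
      exact ⟨E, W, fun _ => ⟨hE, hEn, fun γ hγ => hW _ ⟨γ, hγ, rfl⟩, hWs⟩⟩
    · exact ⟨∅, 0, fun h => absurd h hV⟩
  choose E W h using step
  let V : ℕ → LipFree o →L[ℝ] LipFree o := fun n =>
    Nat.rec (ContinuousLinearMap.id ℝ _) (fun n V => (W n V).comp V) n
  have hVs : ∀ n γ, V (n + 1) γ = W n (V n) (V n γ) := fun n γ => rfl
  have hVR : ∀ n, ∀ γ ∈ Γ, SupportedOn (Metric.closedBall o R) (V n γ) := by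
    intro n
    induction n with
    | zero => exact hΓR
    | succ n ih =>
      intro γ hγ
      rw [hVs]
      exact ((h n (V n) ih).2.2.2 _ _ (ih γ hγ)).mono Set.inter_subset_left
  have hh := fun n => h n (V n) (hVR n)
  refine ⟨{x | ∀ n, Metric.infDist x (E n (V n)) ≤ 2 * δ n},
    isCompact_setOf_infDist_le (fun n => (hh n).1) (fun n => (hh n).2.1) hδ0, fun γ hγ => ?_⟩
  have hdist : ∀ n, dist (V n γ) (V (n + 1) γ) ≤ ε / 2 / 2 ^ n := fun n => by
    rw [dist_eq_norm]
    exact (hh n).2.2.1 γ hγ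
  obtain ⟨μ, hμ⟩ := cauchySeq_tendsto_of_complete (cauchySeq_of_le_geometric_two hdist)
  refine ⟨μ, ?_, SupportedOn.iInter_infDist_le (fun n => (hh n).1) (fun n => (hh n).2.1) hδ0
    fun N => ?_⟩
  · rw [← dist_eq_norm]
    exact dist_le_of_le_geometric_two_of_tendsto₀ hdist hμ
  · have hsupp : ∀ n,
        SupportedOn {x | ∀ k < n, Metric.infDist x (E k (V k)) ≤ 2 * δ k} (V n γ) := by
      intro n
      induction n with
      | zero => exact (supportedOn_univ _).mono fun x _ k hk => absurd hk (Nat.not_lt_zero k)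
      | succ n ih =>
        rw [hVs]
        refine ((hh n).2.2.2 _ _ ih).mono ?_
        rintro x ⟨hx, hx'⟩ k hk
        rcases Nat.lt_succ_iff_lt_or_eq.1 hk with hk | rfl
        · exact hx k hk
        · exact hx'
    -- From index `N` on, all terms are supported on the first `N` neighbourhoods, a condition
    -- closed under limits.
    exact (isClosed_setOf_supportedOn _).mem_of_tendsto hμ
      ((eventually_ge_atTop N).mono fun n hn =>
        (hsupp n).mono fun x hx k hk => hx k (hk.trans_le hn))

theorem IsVStarSet.isTightLipFree [CompleteSpace M] {Γ : Set (LipFree o)} (hΓ : IsVStarSet Γ) :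
    IsTightLipFree o Γ := by
  intro ε hε
  obtain ⟨R, W, hR, hW, hWR⟩ := exists_weight_bounded hΓ (half_pos hε)
  obtain ⟨K, hK, hKΓ⟩ := (hΓ.image W).exists_isCompact_supportedOn hR
    (by rintro _ ⟨γ, -, rfl⟩; exact hWR γ) (half_pos hε)
  refine ⟨insert o K, hK.insert o, Set.mem_insert o K, fun γ hγ => ?_⟩
  obtain ⟨μ, hμ, hμK⟩ := hKΓ _ ⟨γ, hγ, rfl⟩
  refine Set.mem_add.2 ⟨μ, (hμK.mono (Set.subset_insert o K)).mem_lipFreeOn, γ - μ, ?_,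
    add_sub_cancel μ γ⟩
  rw [smul_unitClosedBall, Real.norm_of_nonneg hε.le, mem_closedBall_zero_iff,
    ← sub_add_sub_cancel γ (W γ) μ]
  exact (norm_add_le _ _).trans (by linarith [hW γ hγ])

theorem IsCompact.isSeparable_lipFreeOn {K : Set M} (hK : IsCompact K) :
    TopologicalSpace.IsSeparable (lipFreeOn o K : Set (LipFree o)) :=
  ((hK.isSeparable.image lipschitzWith_lipDelta.continuous).span (R := ℝ)).closure

/-- Tightness with `ε = 1 / (n + 1)` puts `Γ` in the closure of a countable union of separable
subspaces. -/
theorem IsTightLipFree.isSeparable {Γ : Set (LipFree o)} (hΓ : IsTightLipFree o Γ) :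
    TopologicalSpace.IsSeparable Γ := by
  choose K hK _ hΓK using fun n : ℕ => hΓ (1 / ((n : ℝ) + 1)) Nat.one_div_pos_of_nat
  refine ((TopologicalSpace.IsSeparable.iUnion fun n =>
    (hK n).isSeparable_lipFreeOn (o := o)).closure).mono fun γ hγ => ?_
  refine Metric.mem_closure_iff.2 fun ε hε => ?_
  obtain ⟨n, hn⟩ := exists_nat_one_div_lt hε
  obtain ⟨μ, hμ, ν, hν, rfl⟩ := Set.mem_add.1 (hΓK n hγ)
  rw [smul_unitClosedBall, Real.norm_of_nonneg Nat.one_div_pos_of_nat.le,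
    mem_closedBall_zero_iff] at hν
  exact ⟨μ, Set.mem_iUnion.2 ⟨n, hμ⟩, by
    rw [dist_eq_norm, add_sub_cancel_left]; exact hν.trans_lt hn⟩

end Tight

theorem theorem2p6 {M : Type*} [MetricSpace M] [CompleteSpace M] (o : M)
    (Γ : Set (LipFree o)) (hΓ : IsVStarSet Γ) :
    IsTightLipFree o Γ ∧ TopologicalSpace.IsSeparable Γ :=
  ⟨hΓ.isTightLipFree, hΓ.isTightLipFree.isSeparable⟩
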